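/- Let $X=\{x_0,x_1\}$, let $X^*$ be the set of words over $X$ with empty word $1_{X^*}$, and let $\mathbb C\langle\langle X\rangle\rangle$ be the space of noncommutative formal power series $S=\sum_{w\in X^*}\langle S|w\rangle\,w$ with complex coefficients. The shuffle product $\sqcup\!\sqcup$ is the bilinear product on $\mathbb C\langle\langle X\rangle\rangle$ given on words by $u\sqcup\!\sqcup 1_{X^*}=1_{X^*}\sqcup\!\sqcup u=u$ and $au\sqcup\!\sqcup bv=a(u\sqcup\!\sqcup bv)+b(au\sqcup\!\sqcup v)$ for letters $a,b$ and words $u,v$, and extended to series by $\langle S\sqcup\!\sqcup T|w\rangle=\sum_{u,v}\langle S|u\rangle\langle T|v\rangle\langle u\sqcup\!\sqcup v|w\rangle$ (a finite sum). For $w=x_0^{s_1-1}x_1\cdots x_0^{s_r-1}x_1$ with $r\ge 1$ and $s_i\ge 1$, and for $|z|<1$, put $$\operatorname{Li}_w(z)=\sum_{n_1>\cdots>n_r>0}\frac{z^{n_1}}{n_1^{s_1}\cdots n_r^{s_r}},\qquad \operatorname{Li}_{1_{X^*}}=1 .$$ For $S\in\mathbb C\langle\langle X\rangle\rangle x_1\oplus\mathbb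 C\,1_{X^*}$ and $n\ge 0$ let $[S]_n=\sum_{|w|=n}\langle S|w\rangle\,w$ be its homogeneous component of degree $n$, and let $\operatorname{Li}_{[S]_n}=\sum_{|w|=n}\langle S|w\rangle\operatorname{Li}_w$. For $0<R\le 1$ let $\mathcal H(D_{<R})$ be the algebra of holomorphic functions on the disk $|z|<R$ with the topology of locally uniform convergence, and let $\mathrm{Dom}_R(\operatorname{Li})$ be the set of $S\in\mathbb C\langle\langle X\rangle\rangle x_1\oplus\mathbb C\,1_{X^*}$ such that $\sum_{n\ge0}\operatorname{Li}_{[S]_n}$ converges unconditionally in $\mathcal H(D_{<R})$; for such $S$ put $\operatorname{Li}_S=\sum_{n\ge0}\operatorname{Li}_{[S]_n}$. 1. The map $R\mapsto\mathrm{Dom}_R(\operatorname{Li})$ is strictly decreasing on $]0,1]$: if $0<R_1<R_2\le1$, then $\mathrm{Dom}_{R_2}(\operatorname{Li})\subsetneq\mathrm{Dom}_{R_1}(\operatorname{Li})$. More precisely, let $x_1^+=\sum_{n\ge1}x_1^n$ and, for $t\in\mathbb C$, let $S(t)=\sum_{m\ge0}t^m(x_1^+)^{\sqcup\!\sqcup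 m}$. Then $S(t)\in\mathrm{Dom}_{R_1}(\operatorname{Li})$ and $S(t)\notin\mathrm{Dom}_{R_2}(\operatorname{Li})$ for every real $t$ with $\frac1{R_2}-1<t<\frac1{R_1}-1$. Moreover, for every $t\in\mathbb C$ and $n\ge0$, the coefficient of $x_1^n$ in $S(t)$ is $\sum_{m=0}^n m!\,S_2(n,m)\,t^m$, where $S_2(n,m)$ are the Stirling numbers of the second kind. 2. For every $0<R\le1$, $\mathrm{Dom}_R(\operatorname{Li})$ is a shuffle subalgebra of $\mathbb C\langle\langle X\rangle\rangle$ (a linear subspace containing $1_{X^*}$ and closed under $\sqcup\!\sqcup$), and $\operatorname{Li}$ is a shuffle character on it: $S\mapsto\operatorname{Li}_S$ is a linear map from $\mathrm{Dom}_R(\operatorname{Li})$ to $\mathcal H(D_{<R})$ with $\operatorname{Li}_{1_{X^*}}=1$ and $\operatorname{Li}_{S\sqcup\!\sqcup T}=\operatorname{Li}_S\operatorname{Li}_T$ for all $S,T\in\mathrm{Dom}_R(\operatorname{Li})$. -/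

import Mathlib

namespace LocalPolylog

/-- The alphabet `X = {x₀, x₁}`. -/
inductive Letter
  | x0
  | x1
  deriving DecidableEq

instance : Fintype Letter := ⟨{Letter.x0, Letter.x1}, fun a => by cases a <;> simp⟩

/-- Words over `X`: the free monoid `X*`, the empty word being `[]`. -/
abbrev Word := List Letter

/-- Noncommutative formal power series `ℂ⟨⟨X⟩⟩`: `S w` is the coefficient `⟨S | w⟩` of the word `w`
in `S`. Addition and scalar multiplication are coefficientwise. -/
abbrev Series := Word → ℂ

/-- The finite set of all words of length `n`. -/
noncomputable def wordsOfLength (n : ℕ) : Finset Word :=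
  (List.finite_length_eq Letter n).toFinset

/-! ### The shuffle product -/

/-- The shuffle `u ⧢ v` of two words, listed with multiplicity:
`1 ⧢ v = v`, `u ⧢ 1 = u`, `au ⧢ bv = a (u ⧢ bv) + b (au ⧢ v)`. -/
def shuffleWords : Word → Word → List Word
  | [], v => [v]
  | a :: u, [] => [a :: u]
  | a :: u, b :: v =>
      (shuffleWords u (b :: v)).map (fun w => a :: w) ++
        (shuffleWords (a :: u) v).map (fun w => b :: w)
  termination_by u v => u.length + v.length

/-- The shuffle product of two series: `⟨S ⧢ T | w⟩ = ∑ ⟨S | u⟩ ⟨T | v⟩ ⟨u ⧢ v | w⟩`. The words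
occurring in `u ⧢ v` have length `|u| + |v|`, so only the pairs with `|u| + |v| = |w|` count. -/
noncomputable def shuffle (S T : Series) : Series := fun w =>
  ∑ p ∈ Finset.HasAntidiagonal.antidiagonal w.length,
    ∑ u ∈ wordsOfLength p.1, ∑ v ∈ wordsOfLength p.2,
      S u * T v * ((shuffleWords u v).count w : ℂ)

/-- The series `1_{X*}`, the unit for the shuffle product. -/
def oneSeries : Series := fun w => if w = [] then 1 else 0

/-- Shuffle powers `S^{⧢ m}`. -/
noncomputable def shufflePow (S : Series) : ℕ → Series
  | 0 => oneSeries
  | m + 1 => shuffle S (shufflePow S m)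

/-- A shuffle subalgebra of `ℂ⟨⟨X⟩⟩`: a linear subspace containing `1_{X*}` and closed under the
shuffle product. -/
structure IsShuffleSubalgebra (A : Set Series) : Prop where
  one_mem : oneSeries ∈ A
  add_mem : ∀ S ∈ A, ∀ T ∈ A, S + T ∈ A
  smul_mem : ∀ (c : ℂ), ∀ S ∈ A, c • S ∈ A
  shuffle_mem : ∀ S ∈ A, ∀ T ∈ A, shuffle S T ∈ A

/-- `L` is a shuffle character of the shuffle subalgebra `A` with values in the algebra of
holomorphic functions on the open set `D`: it maps `A` to holomorphic functions on `D`, is linear,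
and turns the shuffle product and its unit into the product of functions and its unit. -/
structure IsShuffleCharacterOn (A : Set Series) (D : Set ℂ) (L : Series → ℂ → ℂ) : Prop where
  holomorphic : ∀ S ∈ A, DifferentiableOn ℂ (L S) D
  map_one : ∀ z ∈ D, L oneSeries z = 1
  map_add : ∀ S ∈ A, ∀ T ∈ A, ∀ z ∈ D, L (S + T) z = L S z + L T z
  map_smul : ∀ (c : ℂ), ∀ S ∈ A, ∀ z ∈ D, L (c • S) z = c * L S z
  map_shuffle : ∀ S ∈ A, ∀ T ∈ A, ∀ z ∈ D, L (shuffle S T) z = L S z * L T z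

/-! ### Polylogarithms -/

/-- The harmonic sum `∑_{N ≥ n₁ > ⋯ > n_r > 0} 1 / (n₁^{s₁} ⋯ n_r^{s_r})`, equal to `1` for `r = 0`.
The summation variable `n` is `n₁ - 1`. -/
noncomputable def harmonicSum : List ℕ → ℕ → ℂ
  | [], _ => 1
  | s :: t, N => ∑ n ∈ Finset.range N, harmonicSum t n / ((n : ℂ) + 1) ^ s

/-- The polylogarithm
`Li_{s₁,…,s_r}(z) = ∑_{n₁ > ⋯ > n_r > 0} z^{n₁} / (n₁^{s₁} ⋯ n_r^{s_r})` for `|z| < 1`, equal to `1`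
for `r = 0`. The summation variable `n` is `n₁ - 1`, and the inner sum over `n₂ > ⋯ > n_r` with
`n₂ ≤ n₁ - 1` is a harmonic sum. -/
noncomputable def polylog : List ℕ → ℂ → ℂ
  | [], _ => 1
  | s :: t, z => ∑' n : ℕ, harmonicSum t n / ((n : ℂ) + 1) ^ s * z ^ (n + 1)

/-- The multi-index `[s₁, …, s_r]` of a word `x₀^{s₁-1} x₁ ⋯ x₀^{s_r-1} x₁`. It is only relevant for
such words, i.e. for the empty word and words ending in `x₁`; trailing letters `x₀` are dropped. -/
def multiIndex : Word → List ℕ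
  | [] => []
  | Letter.x1 :: w => 1 :: multiIndex w
  | Letter.x0 :: w =>
      match multiIndex w with
      | [] => []
      | s :: t => (s + 1) :: t

/-- `Li_w = Li_{s₁,…,s_r}` for `w = x₀^{s₁-1} x₁ ⋯ x₀^{s_r-1} x₁`, on the unit disk. -/
noncomputable def liWord (w : Word) (z : ℂ) : ℂ := polylog (multiIndex w) z

/-- `Li_{[S]_n} = ∑_{|w| = n} ⟨S | w⟩ Li_w`, where `[S]_n` is the homogeneous component of `S` of
degree `n`. -/
noncomputable def liComponent (S : Series) (n : ℕ) (z : ℂ) : ℂ :=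
  ∑ w ∈ wordsOfLength n, S w * liWord w z

/-- `Li_S = ∑_{n ≥ 0} Li_{[S]_n}`. -/
noncomputable def liSeries (S : Series) (z : ℂ) : ℂ := ∑' n : ℕ, liComponent S n z

/-- `S ∈ ℂ⟨⟨X⟩⟩x₁ ⊕ ℂ·1_{X*}`: every word in the support of `S` is empty or ends in `x₁`. -/
def IsAdmissible (S : Series) : Prop :=
  ∀ w : Word, S w ≠ 0 → w = [] ∨ ∃ u : Word, w = u ++ [Letter.x1]

/-- `Dom_R(Li)`: the series `S ∈ ℂ⟨⟨X⟩⟩x₁ ⊕ ℂ·1_{X*}` such that `∑_n Li_{[S]_n}` converges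
unconditionally (that is, along the net of all finite sets of indices `n`) in the space of
holomorphic functions on the disk `|z| < R`, with its topology of locally uniform convergence. -/
def domLi (R : ℝ) : Set Series :=
  {S | IsAdmissible S ∧ SummableLocallyUniformlyOn (liComponent S) (Metric.ball (0 : ℂ) R)}

/-! ### The witness of strictness -/

/-- `x₁⁺ = x₁ x₁* = x₁ + x₁² + x₁³ + ⋯`. -/
noncomputable def x1Plus : Series :=
  open Classical in fun w => if ∃ n : ℕ, w = List.replicate (n + 1) Letter.x1 then 1 else 0

/-- `S(t) = ∑_{m ≥ 0} t^m (x₁⁺)^{⧢ m}`. All words of `(x₁⁺)^{⧢ m}` have length at least `m`, so each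
coefficient is a finite sum. -/
noncomputable def witness (t : ℂ) : Series := fun w =>
  ∑ᶠ m : ℕ, t ^ m * shufflePow x1Plus m w

end LocalPolylog

/-! Everything rests on one analytic fact, `summableLocallyUniformlyOn_ball_iff`: on a disk,
unconditional convergence of holomorphic functions is normal convergence. Unconditional convergence
bounds all finite sums outside some finite index set, hence the sums of absolute values at each
point; integrating these over a circle makes the L¹ norms summable, and Cauchy's formula turns L¹
norms into sup norms on a smaller disk.

For the algebra structure, `Li_w` is treated as a formal power series, an iterated integral for `X
d/dX`. The Leibniz rule then reproduces the shuffle recursion (`liPowerSeries_mul`), so the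
components of `S ⧢ T` are the Cauchy product of those of `S` and `T`. Normal convergence is stable
under Cauchy products.

For strictness, `Li` of `x₁ⁿ` is `(-log(1-z))ⁿ/n!`. Exponential generating series turn shuffles of
series in `x₁` into products and send `x₁⁺` to `eˣ - 1`; this yields the Stirling numbers. At `x =
-log(1-r)` with `t ≥ 0`, all terms are nonnegative and the sum is the geometric series of ratio
`t(eˣ - 1) = tr/(1-r)`, convergent exactly when `(1+t)r < 1`. Hence, for `t ≥ 0` and `R ≤ 1`, `S(t)`
lies in `Dom_R` exactly when `(1+t)R ≤ 1`. -/

namespace LocalPolylog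

/-! ### Unconditional and normal convergence on a disk -/

open Finset in
/-- A finite family of complex numbers all of whose partial sums are bounded by `C` has total
absolute value at most `4 * C`. -/
theorem sum_norm_le_of_forall_norm_sum_le {ι : Type*} (a : ι → ℂ) (G : Finset ι) {C : ℝ}
    (h : ∀ F ⊆ G, ‖∑ n ∈ F, a n‖ ≤ C) : ∑ n ∈ G, ‖a n‖ ≤ 4 * C := by
  classical
  -- Splitting a real family by sign costs a factor 2; real and imaginary parts cost another.
  have key (b : ι → ℝ) (hb : ∀ F ⊆ G, |∑ n ∈ F, b n| ≤ C) : ∑ n ∈ G, |b n| ≤ 2 * C := by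
    have h1 := hb (G.filter fun n => 0 ≤ b n) (filter_subset _ _)
    have h2 := hb (G.filter fun n => ¬ 0 ≤ b n) (filter_subset _ _)
    rw [← sum_filter_add_sum_filter_not G (fun n => 0 ≤ b n)]
    have e1 : ∑ n ∈ G with 0 ≤ b n, |b n| = ∑ n ∈ G with 0 ≤ b n, b n :=
      sum_congr rfl fun n hn => abs_of_nonneg (mem_filter.1 hn).2
    have e2 : ∑ n ∈ G with ¬ 0 ≤ b n, |b n| = -∑ n ∈ G with ¬ 0 ≤ b n, b n := by
      rw [← sum_neg_distrib]
      exact sum_congr rfl fun n hn => abs_of_neg (not_le.1 (mem_filter.1 hn).2)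
    rw [e1, e2]
    linarith [le_abs_self (∑ n ∈ G with 0 ≤ b n, b n),
      neg_le_abs (∑ n ∈ G with ¬ 0 ≤ b n, b n)]
  have hre := key (fun n => (a n).re) fun F hF => by
    rw [← Complex.re_sum]; exact (Complex.abs_re_le_norm _).trans (h F hF)
  have him := key (fun n => (a n).im) fun F hF => by
    rw [← Complex.im_sum]; exact (Complex.abs_im_le_norm _).trans (h F hF)
  calc ∑ n ∈ G, ‖a n‖ ≤ ∑ n ∈ G, (|(a n).re| + |(a n).im|) :=
        sum_le_sum fun n _ => Complex.norm_le_abs_re_add_abs_im _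
    _ ≤ 4 * C := by rw [sum_add_distrib]; linarith

/-- The Cauchy estimate of a holomorphic function by its `L¹` norm on a circle. -/
theorem norm_le_integral_norm_circleMap {f : ℂ → ℂ} {r s : ℝ} (hrs : r < s) (hs : 0 < s)
    (hf : DifferentiableOn ℂ f (Metric.closedBall 0 s)) {z : ℂ} (hz : ‖z‖ ≤ r) :
    ‖f z‖ ≤ (2 * Real.pi)⁻¹ * (s * (s - r)⁻¹) *
      ∫ θ in (0 : ℝ)..2 * Real.pi, ‖f (circleMap 0 s θ)‖ := by
  have hzs : z ∈ Metric.ball (0 : ℂ) s := by simpa using hz.trans_lt hrs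
  have hcauchy := hf.circleIntegral_sub_inv_smul hzs
  have hcont : Continuous fun θ : ℝ => f (circleMap 0 s θ) :=
    hf.continuousOn.comp_continuous (continuous_circleMap 0 s) fun θ =>
      Metric.sphere_subset_closedBall (circleMap_mem_sphere 0 hs.le θ)
  have hle : ‖∮ w in C(0, s), (w - z)⁻¹ • f w‖ ≤
      ∫ θ in (0 : ℝ)..2 * Real.pi, s * (s - r)⁻¹ * ‖f (circleMap 0 s θ)‖ := by
    refine intervalIntegral.norm_integral_le_of_norm_le Real.two_pi_pos.le
      (Filter.Eventually.of_forall fun θ _ => ?_)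
      (((continuous_const.mul hcont.norm).intervalIntegrable _ _))
    have h1 : s - r ≤ ‖circleMap 0 s θ - z‖ := by
      have := norm_sub_norm_le (circleMap 0 s θ) z
      rw [norm_circleMap_zero, abs_of_pos hs] at this
      linarith
    rw [norm_smul, norm_smul, norm_inv, deriv_circleMap, norm_mul, norm_circleMap_zero,
      abs_of_pos hs, Complex.norm_I, mul_one, ← mul_assoc]
    gcongr
  rw [intervalIntegral.integral_const_mul, hcauchy, norm_smul] at hle
  have h2 : ‖(2 * Real.pi * Complex.I : ℂ)‖ = 2 * Real.pi := by
    simp [abs_of_pos Real.pi_pos]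
  rw [h2] at hle
  rw [mul_assoc, inv_mul_eq_div, le_div_iff₀ Real.two_pi_pos]
  linarith

/-- In the space of holomorphic functions on a disk, unconditional convergence is the same as
normal convergence. -/
theorem summableLocallyUniformlyOn_ball_iff {f : ℕ → ℂ → ℂ} {R : ℝ}
    (hf : ∀ n, DifferentiableOn ℂ (f n) (Metric.ball 0 R)) :
    SummableLocallyUniformlyOn f (Metric.ball (0 : ℂ) R) ↔
      ∀ r < R, ∃ u : ℕ → ℝ, Summable u ∧ ∀ n, ∀ z : ℂ, ‖z‖ ≤ r → ‖f n z‖ ≤ u n := by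
  constructor
  · rintro ⟨g, hg⟩ r hr
    rcases lt_or_ge r 0 with hr0 | hr0
    · exact ⟨0, summable_zero, fun n z hz => absurd (norm_nonneg z) (by linarith)⟩
    obtain ⟨s, hrs, hsR⟩ := exists_between hr
    have hs : 0 < s := hr0.trans_lt hrs
    have hsub : Metric.closedBall (0 : ℂ) s ⊆ Metric.ball 0 R :=
      Metric.closedBall_subset_ball hsR
    have hunif := (tendstoLocallyUniformlyOn_iff_tendstoUniformlyOn_of_compact
      (isCompact_closedBall (0 : ℂ) s)).1 (TendstoLocallyUniformlyOn.mono hg hsub)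
    rw [Metric.tendstoUniformlyOn_iff] at hunif
    obtain ⟨F₀, hF₀⟩ := Filter.eventually_atTop.1 (hunif 1 one_pos)
    -- Cauchy criterion with ε = 1: the sums over `F₀` and over `G ∪ F₀` are both within 1 of the
    -- limit.
    have hdisj (G : Finset ℕ) (hG : Disjoint G F₀) (z : ℂ) (hz : z ∈ Metric.closedBall (0 : ℂ) s) :
        ‖∑ n ∈ G, f n z‖ ≤ 2 := by
      have h1 := hF₀ F₀ le_rfl z hz
      have h2 := hF₀ (G ∪ F₀) Finset.subset_union_right z hz
      rw [Finset.sum_union hG, dist_eq_norm] at h2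
      rw [dist_eq_norm] at h1
      calc ‖∑ n ∈ G, f n z‖
          = ‖(g z - ∑ n ∈ F₀, f n z) - (g z - (∑ n ∈ G, f n z + ∑ n ∈ F₀, f n z))‖ := by
            congr 1; ring
        _ ≤ _ := norm_sub_le _ _
        _ ≤ 2 := by linarith
    have hnorm (G : Finset ℕ) (hG : Disjoint G F₀) (z : ℂ) (hz : z ∈ Metric.closedBall (0 : ℂ) s) :
        ∑ n ∈ G, ‖f n z‖ ≤ 8 := by
      have := sum_norm_le_of_forall_norm_sum_le (fun n => f n z) G (C := 2)
        fun F hF => hdisj F (Finset.disjoint_of_subset_left hF hG) z hz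
      linarith
    have hmem (θ : ℝ) : circleMap 0 s θ ∈ Metric.closedBall (0 : ℂ) s :=
      Metric.sphere_subset_closedBall (circleMap_mem_sphere 0 hs.le θ)
    have hcont (n : ℕ) : Continuous fun θ : ℝ => ‖f n (circleMap 0 s θ)‖ :=
      (((hf n).mono hsub).continuousOn.comp_continuous (continuous_circleMap 0 s) hmem).norm
    -- The bound 8 controls the sum of `‖f n z‖` at each point, not the sum of the suprema. L¹ norms
    -- on the circle of radius `s` can be summed under the integral, and the gap `s - r` lets
    -- Cauchy's formula recover sup norms.
    refine ⟨fun n => (2 * Real.pi)⁻¹ * (s * (s - r)⁻¹) *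
      ∫ θ in (0 : ℝ)..2 * Real.pi, ‖f n (circleMap 0 s θ)‖, ?_, fun n z hz =>
      norm_le_integral_norm_circleMap hrs hs ((hf n).mono hsub) hz⟩
    refine Summable.mul_left _ ?_
    rw [← Finset.summable_compl_iff F₀]
    refine summable_of_sum_le (c := 8 * (2 * Real.pi)) (fun n =>
      intervalIntegral.integral_nonneg Real.two_pi_pos.le fun _ _ => norm_nonneg _) fun G => ?_
    rw [← intervalIntegral.integral_finsetSum (f := fun (n : {n // n ∉ F₀}) θ =>
      ‖f n (circleMap 0 s θ)‖) fun n _ => (hcont n).intervalIntegrable _ _]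
    have hle := intervalIntegral.integral_mono_on (μ := MeasureTheory.volume)
      Real.two_pi_pos.le
      ((continuous_finsetSum G fun (n : {n // n ∉ F₀}) _ => hcont n).intervalIntegrable 0 (2 * Real.pi))
      (continuous_const.intervalIntegrable 0 (2 * Real.pi) : IntervalIntegrable (fun _ => (8 : ℝ))
        MeasureTheory.volume 0 (2 * Real.pi)) fun θ _ => by
          have := hnorm (G.map (Function.Embedding.subtype _)) (by
            rw [Finset.disjoint_left]
            intro n hn
            obtain ⟨m, -, rfl⟩ := Finset.mem_map.1 hn
            exact m.2) (circleMap 0 s θ) (hmem θ)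
          rwa [Finset.sum_map] at this
    refine hle.trans (le_of_eq ?_)
    rw [intervalIntegral.integral_const, smul_eq_mul]
    ring
  · intro h
    refine SummableLocallyUniformlyOn_of_locally_bounded Metric.isOpen_ball fun K hK hKc => ?_
    obtain ⟨r, hr, hKr⟩ : ∃ r < R, K ⊆ Metric.closedBall 0 r := by
      rcases K.eq_empty_or_nonempty with rfl | hne
      · exact ⟨R - 1, by linarith, Set.empty_subset _⟩
      · obtain ⟨x, hx, hmax⟩ := hKc.exists_isMaxOn hne continuous_norm.continuousOn
        exact ⟨‖x‖, by simpa using hK hx, fun y hy => by simpa using hmax hy⟩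
    obtain ⟨u, hu, hb⟩ := h r hr
    exact ⟨u, hu, fun n z hz => hb n z (by simpa using hKr hz)⟩

/-! ### Words occurring in a shuffle -/

theorem mem_wordsOfLength {n : ℕ} {w : Word} : w ∈ wordsOfLength n ↔ w.length = n := by
  simp [wordsOfLength]

theorem perm_append_of_mem_shuffleWords (u v : Word) :
    ∀ w ∈ shuffleWords u v, w.Perm (u ++ v) := by
  induction u, v using shuffleWords.induct with
  | case1 v => simp [shuffleWords]
  | case2 a u => simp [shuffleWords]
  | case3 a u b v ih1 ih2 =>
    intro w hw
    rw [shuffleWords, List.mem_append, List.mem_map, List.mem_map] at hw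
    rcases hw with ⟨w, hw, rfl⟩ | ⟨w, hw, rfl⟩
    · exact (ih1 w hw).cons a
    · exact ((ih2 w hw).cons b).trans List.perm_middle.symm

theorem length_of_mem_shuffleWords {u v w : Word} (h : w ∈ shuffleWords u v) :
    w.length = u.length + v.length := by
  simpa using (perm_append_of_mem_shuffleWords u v w h).length_eq

/-- A word of `X* x₁ ∪ {1}`. -/
def AdmissibleWord (w : Word) : Prop := w = [] ∨ ∃ u : Word, w = u ++ [Letter.x1]

theorem admissibleWord_nil : AdmissibleWord [] := Or.inl rfl

theorem AdmissibleWord.of_cons {a : Letter} {w : Word} (h : AdmissibleWord (a :: w)) :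
    AdmissibleWord w := by
  rcases h with h | ⟨u, h⟩
  · simp at h
  · cases u with
    | nil => simp at h; exact Or.inl h.2
    | cons b u => simp at h; exact Or.inr ⟨u, h.2⟩

theorem AdmissibleWord.cons {w : Word} (h : AdmissibleWord w) (hw : w ≠ []) (a : Letter) :
    AdmissibleWord (a :: w) := by
  rcases h with h | ⟨u, rfl⟩
  · exact absurd h hw
  · exact Or.inr ⟨a :: u, rfl⟩

theorem AdmissibleWord.cons_x1 {w : Word} (h : AdmissibleWord w) :
    AdmissibleWord (Letter.x1 :: w) := by
  rcases h with rfl | ⟨u, rfl⟩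
  · exact Or.inr ⟨[], rfl⟩
  · exact Or.inr ⟨Letter.x1 :: u, rfl⟩

theorem AdmissibleWord.ne_nil_of_cons_x0 {w : Word} (h : AdmissibleWord (Letter.x0 :: w)) :
    w ≠ [] := by
  rintro rfl
  rcases h with h | ⟨u, h⟩
  · simp at h
  · cases u <;> simp at h

theorem admissibleWord_replicate (n : ℕ) : AdmissibleWord (List.replicate n Letter.x1) := by
  induction n with
  | zero => exact admissibleWord_nil
  | succ n ih => exact ih.cons_x1

theorem AdmissibleWord.of_mem_shuffleWords (u v : Word) (hu : AdmissibleWord u)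
    (hv : AdmissibleWord v) : ∀ w ∈ shuffleWords u v, AdmissibleWord w := by
  induction u, v using shuffleWords.induct with
  | case1 v => simpa [shuffleWords] using hv
  | case2 a u => simpa [shuffleWords] using hu
  | case3 a u b v ih1 ih2 =>
    intro w hw
    rw [shuffleWords, List.mem_append, List.mem_map, List.mem_map] at hw
    rcases hw with ⟨w, hw, rfl⟩ | ⟨w, hw, rfl⟩
    · refine (ih1 hu.of_cons hv w hw).cons (fun h => ?_) a
      have := length_of_mem_shuffleWords hw
      simp only [h, List.length_nil, List.length_cons] at this
      omega
    · refine (ih2 hu hv.of_cons w hw).cons (fun h => ?_) b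
      have := length_of_mem_shuffleWords hw
      simp only [h, List.length_nil, List.length_cons] at this
      omega

/-- Bridge between the multiplicities used in `shuffle` and the list sums produced by the recursion
of `shuffleWords`. -/
theorem sum_map_shuffleWords {M : Type*} [AddCommGroup M] [Module ℂ M] (u v : Word)
    (f : Word → M) :
    ∑ w ∈ wordsOfLength (u.length + v.length), ((shuffleWords u v).count w : ℂ) • f w =
      ((shuffleWords u v).map f).sum := by
  rw [Finset.sum_list_map_count]
  symm
  refine Finset.sum_subset_zero_on_sdiff (fun w hw => ?_) (fun w hw => ?_) fun w _ => ?_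
  · exact mem_wordsOfLength.2 (length_of_mem_shuffleWords (List.mem_toFinset.1 hw))
  · rw [Finset.mem_sdiff, List.mem_toFinset] at hw
    simp [List.count_eq_zero_of_not_mem hw.2]
  · rw [Nat.cast_smul_eq_nsmul]
    congr!

/-! ### Polylogarithms as power series -/

open PowerSeries

/-- The antiderivative without constant term for the derivation `X d/dX`. -/
noncomputable def eulerIntegral (f : PowerSeries ℂ) : PowerSeries ℂ :=
  PowerSeries.mk fun n => coeff n f / n

/-- The differential form attached to a letter, as a power series: `x₀ ↦ 1`, `x₁ ↦ X / (1 - X)`. -/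
noncomputable def letterSeries : Letter → PowerSeries ℂ
  | Letter.x0 => 1
  | Letter.x1 => X * PowerSeries.mk 1

/-- The Taylor series of `Li_w` at the origin, for an admissible word `w`. -/
noncomputable def liPowerSeries : Word → PowerSeries ℂ
  | [] => 1
  | a :: w => eulerIntegral (letterSeries a * liPowerSeries w)

theorem coeff_eulerIntegral (f : PowerSeries ℂ) (n : ℕ) :
    coeff n (eulerIntegral f) = coeff n f / n := by
  simp [eulerIntegral]

/-- The coefficient of index 0 is divided by `0`, which gives `0`: the integral is normalised to
vanish at the origin. -/
theorem constantCoeff_liPowerSeries_cons (a : Letter) (w : Word) :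
    constantCoeff (liPowerSeries (a :: w)) = 0 := by
  rw [liPowerSeries, ← coeff_zero_eq_constantCoeff_apply, coeff_eulerIntegral]
  simp

theorem X_mul_derivative_eulerIntegral {f : PowerSeries ℂ} (hf : constantCoeff f = 0) :
    X * derivative ℂ (eulerIntegral f) = f := by
  ext n
  cases n with
  | zero => simp [hf]
  | succ n =>
    rw [coeff_succ_X_mul, coeff_derivative, coeff_eulerIntegral]
    have : (n : ℂ) + 1 ≠ 0 := Nat.cast_add_one_ne_zero n
    push_cast
    field_simp

/-- Admissibility enters here: the right side must have no constant term. For `x₁` the factor `X`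
ensures this; for `x₀` the rest of the word is nonempty. -/
theorem X_mul_derivative_liPowerSeries_cons {a : Letter} {w : Word}
    (h : AdmissibleWord (a :: w)) :
    X * derivative ℂ (liPowerSeries (a :: w)) = letterSeries a * liPowerSeries w := by
  rw [liPowerSeries]
  refine X_mul_derivative_eulerIntegral ?_
  cases a with
  | x1 => simp [letterSeries]
  | x0 =>
    cases w with
    | nil => exact absurd rfl h.ne_nil_of_cons_x0
    | cons b w => rw [map_mul, constantCoeff_liPowerSeries_cons, mul_zero]

theorem eq_of_X_mul_derivative_eq {f g : PowerSeries ℂ}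
    (h : X * derivative ℂ f = X * derivative ℂ g) (h0 : constantCoeff f = constantCoeff g) :
    f = g :=
  derivative.ext (mul_left_cancel₀ X_ne_zero h) h0

/-- Polylogarithms multiply by the shuffle product. -/
theorem liPowerSeries_mul (u v : Word) (hu : AdmissibleWord u) (hv : AdmissibleWord v) :
    liPowerSeries u * liPowerSeries v = ((shuffleWords u v).map liPowerSeries).sum := by
  induction u, v using shuffleWords.induct with
  | case1 v => simp [shuffleWords, liPowerSeries]
  | case2 a u => simp [shuffleWords, liPowerSeries]
  | case3 a u b v ih1 ih2 =>
    have hcons (c : Letter) (l : List Word) (hl : ∀ w ∈ l, AdmissibleWord (c :: w)) :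
        X * derivative ℂ ((l.map fun w => liPowerSeries (c :: w)).sum) =
          letterSeries c * (l.map liPowerSeries).sum ∧
        constantCoeff ((l.map fun w => liPowerSeries (c :: w)).sum) = 0 := by
      induction l with
      | nil => simp
      | cons w l ih =>
        have ih := ih fun w hw => hl w (List.mem_cons_of_mem _ hw)
        simp only [List.map_cons, List.sum_cons, map_add, mul_add, ih.1, ih.2,
          X_mul_derivative_liPowerSeries_cons (hl w List.mem_cons_self),
          constantCoeff_liPowerSeries_cons, add_zero, and_self]
    have hadm := AdmissibleWord.of_mem_shuffleWords _ _ hu hv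
    rw [shuffleWords] at hadm ⊢
    have h1 := hcons a (shuffleWords u (b :: v)) fun w hw =>
      hadm _ (List.mem_append_left _ (List.mem_map_of_mem hw))
    have h2 := hcons b (shuffleWords (a :: u) v) fun w hw =>
      hadm _ (List.mem_append_right _ (List.mem_map_of_mem hw))
    rw [List.map_append, List.sum_append, List.map_map, List.map_map]
    simp only [Function.comp_def]
    -- Both sides solve the same equation: Leibniz gives one term removing `a` from the left word
    -- and one removing `b` from the right word, as in the shuffle recursion.
    refine eq_of_X_mul_derivative_eq ?_ ?_
    · rw [map_add, mul_add, h1.1, h2.1, ← ih1 hu.of_cons hv, ← ih2 hu hv.of_cons,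
        Derivation.leibniz, smul_eq_mul, smul_eq_mul, mul_add, mul_left_comm, mul_left_comm X,
        X_mul_derivative_liPowerSeries_cons hu, X_mul_derivative_liPowerSeries_cons hv]
      ring
    · rw [map_mul, map_add, h1.2, h2.2, constantCoeff_liPowerSeries_cons]
      simp

/-- Multiplying by `X / (1 - X)` takes partial sums with a shift by one, which is the source of the
strict inequalities `n₁ > n₂ > ⋯`. -/
theorem coeff_succ_letterSeries_x1_mul (f : PowerSeries ℂ) (n : ℕ) :
    coeff (n + 1) (letterSeries Letter.x1 * f) = ∑ k ∈ Finset.range (n + 1), coeff k f := by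
  rw [letterSeries, mul_assoc, coeff_succ_X_mul, mul_comm, coeff_mul,
    Finset.Nat.sum_antidiagonal_eq_sum_range_succ_mk]
  simp

/-- The coefficients of `Li_w` are harmonic sums. -/
theorem coeff_succ_liPowerSeries (w : Word) (hw : AdmissibleWord w) (hne : w ≠ []) :
    ∃ s t, multiIndex w = s :: t ∧
      ∀ n, coeff (n + 1) (liPowerSeries w) = harmonicSum t n / ((n : ℂ) + 1) ^ s := by
  induction w with
  | nil => exact absurd rfl hne
  | cons a w ih =>
    cases a with
    | x0 =>
      obtain ⟨s, t, h, hc⟩ := ih hw.of_cons hw.ne_nil_of_cons_x0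
      refine ⟨s + 1, t, by simp [multiIndex, h], fun n => ?_⟩
      rw [liPowerSeries, coeff_eulerIntegral, letterSeries, one_mul, hc, pow_succ, div_div]
      push_cast
      rfl
    | x1 =>
      refine ⟨1, multiIndex w, by simp [multiIndex], fun n => ?_⟩
      rw [liPowerSeries, coeff_eulerIntegral, coeff_succ_letterSeries_x1_mul, pow_one]
      push_cast
      congr 1
      cases w with
      | nil => simp [liPowerSeries, multiIndex, harmonicSum, coeff_one]
      | cons b w =>
        obtain ⟨s, t, h, hc⟩ := ih hw.of_cons (by simp)
        rw [h, harmonicSum, Finset.sum_range_succ', coeff_zero_eq_constantCoeff_apply,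
          constantCoeff_liPowerSeries_cons, add_zero]
        exact Finset.sum_congr rfl fun n _ => hc n

/-! ### Evaluation of power series -/

/-- The power series converges absolutely on the closed disk of radius `r`. -/
def SummableAt (r : ℝ) (f : PowerSeries ℂ) : Prop := Summable fun n => ‖coeff n f‖ * r ^ n

/-- The value of a power series at a point. -/
noncomputable def evalAt (z : ℂ) (f : PowerSeries ℂ) : ℂ := ∑' n, coeff n f * z ^ n

theorem SummableAt.summable_norm {z : ℂ} {f : PowerSeries ℂ} (hf : SummableAt ‖z‖ f) :
    Summable fun n => ‖coeff n f * z ^ n‖ := by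
  simpa only [norm_mul, norm_pow, SummableAt] using hf

theorem SummableAt.hasSum {z : ℂ} {f : PowerSeries ℂ} (hf : SummableAt ‖z‖ f) :
    HasSum (fun n => coeff n f * z ^ n) (evalAt z f) :=
  hf.summable_norm.of_norm.hasSum

theorem SummableAt.norm_evalAt_le {z : ℂ} {f : PowerSeries ℂ} (hf : SummableAt ‖z‖ f) :
    ‖evalAt z f‖ ≤ ∑' n, ‖coeff n f‖ * ‖z‖ ^ n := by
  simpa only [norm_mul, norm_pow, evalAt] using norm_tsum_le_tsum_norm hf.summable_norm

theorem summableAt_one (r : ℝ) : SummableAt r 1 := by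
  refine summable_of_ne_finset_zero (s := {0}) fun n hn => ?_
  simp [coeff_one, Finset.notMem_singleton.1 hn]

theorem evalAt_one (z : ℂ) : evalAt z 1 = 1 := by
  rw [evalAt, tsum_eq_single 0 fun n hn => by simp [coeff_one, hn]]
  simp

theorem evalAt_zero (z : ℂ) : evalAt z 0 = 0 := by simp [evalAt]

theorem SummableAt.add {r : ℝ} (hr : 0 ≤ r) {f g : PowerSeries ℂ} (hf : SummableAt r f)
    (hg : SummableAt r g) : SummableAt r (f + g) := by
  refine Summable.of_nonneg_of_le (fun n => by positivity) (fun n => ?_) (Summable.add hf hg)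
  rw [map_add, ← add_mul]
  gcongr
  exact norm_add_le _ _

theorem SummableAt.smul {r : ℝ} {f : PowerSeries ℂ} (hf : SummableAt r f) (c : ℂ) :
    SummableAt r (c • f) := by
  simpa only [SummableAt, coeff_smul, smul_eq_mul, norm_mul, mul_assoc] using hf.mul_left ‖c‖

theorem SummableAt.mul {r : ℝ} (hr : 0 ≤ r) {f g : PowerSeries ℂ} (hf : SummableAt r f)
    (hg : SummableAt r g) : SummableAt r (f * g) := by
  have h := summable_sum_mul_antidiagonal_of_summable_mul (f := fun n => ‖coeff n f‖ * r ^ n)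
    (g := fun n => ‖coeff n g‖ * r ^ n) (Summable.mul_of_nonneg hf hg
      (fun n => by positivity) (fun n => by positivity))
  refine Summable.of_nonneg_of_le (fun n => by positivity) (fun n => ?_) h
  rw [coeff_mul]
  calc _ ≤ (∑ p ∈ Finset.HasAntidiagonal.antidiagonal n, ‖coeff p.1 f * coeff p.2 g‖) * r ^ n := by
        gcongr; exact norm_sum_le _ _
    _ = _ := by
      rw [Finset.sum_mul]
      refine Finset.sum_congr rfl fun p hp => ?_
      rw [← Finset.HasAntidiagonal.mem_antidiagonal.1 hp, norm_mul, pow_add]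
      ring

theorem evalAt_mul {z : ℂ} {f g : PowerSeries ℂ} (hf : SummableAt ‖z‖ f)
    (hg : SummableAt ‖z‖ g) : evalAt z (f * g) = evalAt z f * evalAt z g := by
  rw [evalAt, evalAt, evalAt,
    tsum_mul_tsum_eq_tsum_sum_antidiagonal_of_summable_norm hf.summable_norm hg.summable_norm]
  refine tsum_congr fun n => ?_
  rw [coeff_mul, Finset.sum_mul]
  refine Finset.sum_congr rfl fun p hp => ?_
  rw [← Finset.HasAntidiagonal.mem_antidiagonal.1 hp, pow_add]
  ring

theorem evalAt_add {z : ℂ} {f g : PowerSeries ℂ} (hf : SummableAt ‖z‖ f)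
    (hg : SummableAt ‖z‖ g) : evalAt z (f + g) = evalAt z f + evalAt z g := by
  rw [evalAt, evalAt, evalAt, ← hf.summable_norm.of_norm.tsum_add hg.summable_norm.of_norm]
  simp only [map_add, add_mul]

theorem evalAt_smul (z c : ℂ) (f : PowerSeries ℂ) : evalAt z (c • f) = c * evalAt z f := by
  simp only [evalAt, coeff_smul, smul_eq_mul, mul_assoc, tsum_mul_left]

theorem SummableAt.sum {r : ℝ} (hr : 0 ≤ r) {ι : Type*} (s : Finset ι) {f : ι → PowerSeries ℂ}
    (hf : ∀ i, SummableAt r (f i)) : SummableAt r (∑ i ∈ s, f i) := by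
  classical
  induction s using Finset.induction_on with
  | empty => simp [SummableAt, summable_zero]
  | insert i s hi ih => rw [Finset.sum_insert hi]; exact (hf i).add hr ih

theorem evalAt_sum {z : ℂ} {ι : Type*} (s : Finset ι) {f : ι → PowerSeries ℂ}
    (hf : ∀ i, SummableAt ‖z‖ (f i)) : evalAt z (∑ i ∈ s, f i) = ∑ i ∈ s, evalAt z (f i) := by
  classical
  induction s using Finset.induction_on with
  | empty => simp [evalAt_zero]
  | insert i s hi ih =>
    rw [Finset.sum_insert hi, Finset.sum_insert hi,
      evalAt_add (hf i) (SummableAt.sum (norm_nonneg z) s hf), ih]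

theorem SummableAt.pow {r : ℝ} (hr : 0 ≤ r) {f : PowerSeries ℂ} (hf : SummableAt r f) (m : ℕ) :
    SummableAt r (f ^ m) := by
  induction m with
  | zero => simpa using summableAt_one r
  | succ m ih => rw [pow_succ]; exact ih.mul hr hf

theorem evalAt_pow {z : ℂ} {f : PowerSeries ℂ} (hf : SummableAt ‖z‖ f) (m : ℕ) :
    evalAt z (f ^ m) = evalAt z f ^ m := by
  induction m with
  | zero => simp [evalAt_one]
  | succ m ih => rw [pow_succ, pow_succ, evalAt_mul (hf.pow (norm_nonneg z) m) hf, ih]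

theorem SummableAt.eulerIntegral {r : ℝ} (hr : 0 ≤ r) {f : PowerSeries ℂ} (hf : SummableAt r f) :
    SummableAt r (eulerIntegral f) := by
  refine Summable.of_nonneg_of_le (fun n => by positivity) (fun n => ?_) hf
  rw [coeff_eulerIntegral, norm_div, Complex.norm_natCast]
  gcongr
  rcases n.eq_zero_or_pos with rfl | hn
  · simp
  · exact div_le_self (norm_nonneg _) (by exact_mod_cast hn)

theorem summableAt_letterSeries {r : ℝ} (hr : 0 ≤ r) (hr1 : r < 1) (a : Letter) :
    SummableAt r (letterSeries a) := by
  cases a with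
  | x0 => exact summableAt_one r
  | x1 =>
    refine SummableAt.mul hr ?_ ?_
    · refine summable_of_ne_finset_zero (s := {1}) fun n hn => ?_
      simp [coeff_X, Finset.notMem_singleton.1 hn]
    · simpa [SummableAt] using summable_geometric_of_lt_one hr hr1

theorem summableAt_liPowerSeries {r : ℝ} (hr : 0 ≤ r) (hr1 : r < 1) (w : Word) :
    SummableAt r (liPowerSeries w) := by
  induction w with
  | nil => exact summableAt_one r
  | cons a w ih => exact ((summableAt_letterSeries hr hr1 a).mul hr ih).eulerIntegral hr

theorem liWord_eq_evalAt {w : Word} (hw : AdmissibleWord w) {z : ℂ} (hz : ‖z‖ < 1) :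
    liWord w z = evalAt z (liPowerSeries w) := by
  rcases eq_or_ne w [] with rfl | hne
  · simp [liWord, multiIndex, polylog, liPowerSeries, evalAt_one]
  · obtain ⟨s, t, h, hc⟩ := coeff_succ_liPowerSeries w hw hne
    have hsum := (summableAt_liPowerSeries (norm_nonneg z) hz w).summable_norm.of_norm
    have h0 : coeff 0 (liPowerSeries w) = 0 := by
      cases w with
      | nil => exact absurd rfl hne
      | cons a w => simpa using constantCoeff_liPowerSeries_cons a w
    rw [liWord, h, polylog, evalAt, hsum.tsum_eq_zero_add, h0, zero_mul, zero_add]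
    exact tsum_congr fun n => by rw [hc]

theorem differentiableOn_evalAt {f : PowerSeries ℂ} {R : ℝ}
    (hf : ∀ r, 0 ≤ r → r < R → SummableAt r f) :
    DifferentiableOn ℂ (fun z => evalAt z f) (Metric.ball 0 R) := by
  intro z hz
  rw [mem_ball_zero_iff] at hz
  obtain ⟨r, hzr, hrR⟩ := exists_between hz
  have hr : 0 ≤ r := (norm_nonneg z).trans hzr.le
  refine DifferentiableAt.differentiableWithinAt ?_
  refine (Complex.differentiableOn_tsum_of_summable_norm (hf r hr hrR)
    (F := fun n z => coeff n f * z ^ n) (fun n => by fun_prop) Metric.isOpen_ball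
    fun n w hw => ?_).differentiableAt
      (Metric.isOpen_ball.mem_nhds (mem_ball_zero_iff.2 hzr))
  rw [mem_ball_zero_iff] at hw
  rw [norm_mul, norm_pow]
  gcongr

/-! ### Homogeneous components and their shuffle products -/

/-- The Taylor series of `Li_{[S]_n}` at the origin. -/
noncomputable def componentSeries (S : Series) (n : ℕ) : PowerSeries ℂ :=
  ∑ w ∈ wordsOfLength n, S w • liPowerSeries w

theorem summableAt_componentSeries {r : ℝ} (hr : 0 ≤ r) (hr1 : r < 1) (S : Series) (n : ℕ) :
    SummableAt r (componentSeries S n) :=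
  SummableAt.sum hr _ fun w => (summableAt_liPowerSeries hr hr1 w).smul (S w)

/-- On words ending in `x₀`, `liWord` and `liPowerSeries` need not agree; admissibility makes their
coefficients vanish. -/
theorem liComponent_eq_evalAt {S : Series} (hS : IsAdmissible S) (n : ℕ) {z : ℂ} (hz : ‖z‖ < 1) :
    liComponent S n z = evalAt z (componentSeries S n) := by
  rw [liComponent, componentSeries,
    evalAt_sum _ fun w => (summableAt_liPowerSeries (norm_nonneg z) hz w).smul (S w)]
  refine Finset.sum_congr rfl fun w _ => ?_
  rw [evalAt_smul]
  by_cases hw : S w = 0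
  · simp [hw]
  · rw [liWord_eq_evalAt (hS w hw) hz]

theorem differentiableOn_liComponent {S : Series} (hS : IsAdmissible S) (n : ℕ) {R : ℝ}
    (hR : R ≤ 1) : DifferentiableOn ℂ (liComponent S n) (Metric.ball 0 R) :=
  (differentiableOn_evalAt fun _ h0 h1 =>
    summableAt_componentSeries h0 (h1.trans_le hR) S n).congr fun _ hz =>
      liComponent_eq_evalAt hS n ((mem_ball_zero_iff.1 hz).trans_le hR)

theorem componentSeries_shuffle {S T : Series} (hS : IsAdmissible S) (hT : IsAdmissible T)
    (n : ℕ) : componentSeries (shuffle S T) n =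
      ∑ p ∈ Finset.HasAntidiagonal.antidiagonal n,
        componentSeries S p.1 * componentSeries T p.2 := by
  calc componentSeries (shuffle S T) n
      = ∑ w ∈ wordsOfLength n, ∑ p ∈ Finset.HasAntidiagonal.antidiagonal n,
          ∑ u ∈ wordsOfLength p.1, ∑ v ∈ wordsOfLength p.2,
            (S u * T v * ((shuffleWords u v).count w : ℂ)) • liPowerSeries w := by
        refine Finset.sum_congr rfl fun w hw => ?_
        rw [shuffle, mem_wordsOfLength.1 hw]
        simp only [Finset.sum_smul]
    _ = ∑ p ∈ Finset.HasAntidiagonal.antidiagonal n,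
          ∑ u ∈ wordsOfLength p.1, ∑ v ∈ wordsOfLength p.2, ∑ w ∈ wordsOfLength n,
            (S u * T v * ((shuffleWords u v).count w : ℂ)) • liPowerSeries w := by
        rw [Finset.sum_comm]
        refine Finset.sum_congr rfl fun p _ => ?_
        rw [Finset.sum_comm]
        exact Finset.sum_congr rfl fun u _ => Finset.sum_comm
    _ = _ := by
        refine Finset.sum_congr rfl fun p hp => ?_
        rw [componentSeries, componentSeries, Finset.sum_mul_sum]
        refine Finset.sum_congr rfl fun u hu => Finset.sum_congr rfl fun v hv => ?_
        rw [smul_mul_smul_comm]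
        -- `liPowerSeries_mul` needs admissible words; the other pairs carry a zero coefficient.
        by_cases h : S u = 0 ∨ T v = 0
        · have : S u * T v = 0 := mul_eq_zero.2 h
          simp [this]
        rw [not_or] at h
        rw [liPowerSeries_mul u v (hS u h.1) (hT v h.2), ← sum_map_shuffleWords,
          mem_wordsOfLength.1 hu, mem_wordsOfLength.1 hv,
          Finset.HasAntidiagonal.mem_antidiagonal.1 hp, Finset.smul_sum]
        simp only [mul_smul]

theorem liComponent_shuffle {S T : Series} (hS : IsAdmissible S) (hT : IsAdmissible T)
    (hST : IsAdmissible (shuffle S T)) (n : ℕ) {z : ℂ} (hz : ‖z‖ < 1) :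
    liComponent (shuffle S T) n z =
      ∑ p ∈ Finset.HasAntidiagonal.antidiagonal n, liComponent S p.1 z * liComponent T p.2 z := by
  have hs (S : Series) (n : ℕ) : SummableAt ‖z‖ (componentSeries S n) :=
    summableAt_componentSeries (norm_nonneg z) hz S n
  have hmul (p : ℕ × ℕ) : SummableAt ‖z‖ (componentSeries S p.1 * componentSeries T p.2) :=
    (hs S p.1).mul (norm_nonneg z) (hs T p.2)
  rw [liComponent_eq_evalAt hST n hz, componentSeries_shuffle hS hT, evalAt_sum _ hmul]
  refine Finset.sum_congr rfl fun p _ => ?_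
  rw [evalAt_mul (hs S p.1) (hs T p.2), liComponent_eq_evalAt hS _ hz,
    liComponent_eq_evalAt hT _ hz]

theorem exists_mem_shuffleWords_of_shuffle_ne_zero {S T : Series} {w : Word}
    (h : shuffle S T w ≠ 0) : ∃ u v, S u ≠ 0 ∧ T v ≠ 0 ∧ w ∈ shuffleWords u v := by
  rw [shuffle] at h
  obtain ⟨p, -, h⟩ := Finset.exists_ne_zero_of_sum_ne_zero h
  obtain ⟨u, -, h⟩ := Finset.exists_ne_zero_of_sum_ne_zero h
  obtain ⟨v, -, h⟩ := Finset.exists_ne_zero_of_sum_ne_zero h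
  refine ⟨u, v, fun h0 => h (by simp [h0]), fun h0 => h (by simp [h0]), ?_⟩
  by_contra hw
  exact h (by simp [List.count_eq_zero_of_not_mem hw])

theorem IsAdmissible.shuffle {S T : Series} (hS : IsAdmissible S) (hT : IsAdmissible T) :
    IsAdmissible (shuffle S T) := fun w hw => by
  obtain ⟨u, v, hu, hv, hw⟩ := exists_mem_shuffleWords_of_shuffle_ne_zero hw
  exact AdmissibleWord.of_mem_shuffleWords u v (hS u hu) (hT v hv) w hw

theorem IsAdmissible.add {S T : Series} (hS : IsAdmissible S) (hT : IsAdmissible T) :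
    IsAdmissible (S + T) := fun w hw => by
  by_cases h : S w = 0
  · exact hT w fun h' => hw (by simp [h, h'])
  · exact hS w h

theorem IsAdmissible.smul {S : Series} (hS : IsAdmissible S) (c : ℂ) : IsAdmissible (c • S) :=
  fun w hw => hS w fun h => hw (by simp [h])

theorem isAdmissible_oneSeries : IsAdmissible oneSeries := fun w hw => by
  by_cases h : w = []
  · exact Or.inl h
  · exact absurd (by simp [oneSeries, h]) hw

theorem liComponent_add (S T : Series) (n : ℕ) (z : ℂ) :
    liComponent (S + T) n z = liComponent S n z + liComponent T n z := by
  simp [liComponent, add_mul, Finset.sum_add_distrib]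

theorem liComponent_smul (c : ℂ) (S : Series) (n : ℕ) (z : ℂ) :
    liComponent (c • S) n z = c * liComponent S n z := by
  simp [liComponent, mul_assoc, Finset.mul_sum]

theorem liComponent_oneSeries (n : ℕ) (z : ℂ) :
    liComponent oneSeries n z = if n = 0 then 1 else 0 := by
  rw [liComponent]
  split_ifs with h
  · subst h
    rw [Finset.sum_eq_single [] (fun w _ hw => by simp [oneSeries, hw])
      fun h => absurd (mem_wordsOfLength.2 List.length_nil) h]
    simp [oneSeries, liWord, multiIndex, polylog]
  · refine Finset.sum_eq_zero fun w hw => ?_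
    have : w ≠ [] := fun h' => h (by rw [← mem_wordsOfLength.1 hw, h', List.length_nil])
    simp [oneSeries, this]

/-! ### The domains as shuffle algebras and the character -/

/-- A series is in the domain of radius `R` if and only if its components converge normally. -/
theorem mem_domLi_iff {S : Series} {R : ℝ} (hR : R ≤ 1) :
    S ∈ domLi R ↔ IsAdmissible S ∧ ∀ r < R, ∃ u : ℕ → ℝ, Summable u ∧
      ∀ n, ∀ z : ℂ, ‖z‖ ≤ r → ‖liComponent S n z‖ ≤ u n :=
  and_congr_right fun hS =>
    summableLocallyUniformlyOn_ball_iff fun n => differentiableOn_liComponent hS n hR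

theorem summable_norm_liComponent {S : Series} {R : ℝ} (hR : R ≤ 1) (hS : S ∈ domLi R) {z : ℂ}
    (hz : ‖z‖ < R) : Summable fun n => ‖liComponent S n z‖ := by
  obtain ⟨u, hu, hb⟩ := ((mem_domLi_iff hR).1 hS).2 ‖z‖ hz
  exact Summable.of_nonneg_of_le (fun n => norm_nonneg _) (fun n => hb n z le_rfl) hu

theorem domLi_subset_domLi {R₁ R₂ : ℝ} (h : R₁ ≤ R₂) : domLi R₂ ⊆ domLi R₁ := fun _ hS =>
  ⟨hS.1, SummableLocallyUniformlyOn.mono hS.2 (Metric.ball_subset_ball h)⟩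

theorem isShuffleSubalgebra_domLi {R : ℝ} (hR : R ≤ 1) : IsShuffleSubalgebra (domLi R) where
  one_mem := by
    refine (mem_domLi_iff hR).2 ⟨isAdmissible_oneSeries, fun r _ =>
      ⟨fun n => if n = 0 then 1 else 0, ?_, fun n z _ => ?_⟩⟩
    · exact summable_of_ne_finset_zero (s := {0}) fun n hn => by simp_all
    · rw [liComponent_oneSeries]
      by_cases h : n = 0 <;> simp [h]
  add_mem S hS T hT := by
    rw [mem_domLi_iff hR] at hS hT ⊢
    refine ⟨hS.1.add hT.1, fun r hr => ?_⟩
    obtain ⟨u, hu, hu'⟩ := hS.2 r hr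
    obtain ⟨v, hv, hv'⟩ := hT.2 r hr
    refine ⟨u + v, hu.add hv, fun n z hz => ?_⟩
    rw [liComponent_add]
    exact norm_add_le_of_le (hu' n z hz) (hv' n z hz)
  smul_mem c S hS := by
    rw [mem_domLi_iff hR] at hS ⊢
    refine ⟨hS.1.smul c, fun r hr => ?_⟩
    obtain ⟨u, hu, hu'⟩ := hS.2 r hr
    refine ⟨fun n => ‖c‖ * u n, hu.mul_left _, fun n z hz => ?_⟩
    rw [liComponent_smul, norm_mul]
    exact mul_le_mul_of_nonneg_left (hu' n z hz) (norm_nonneg c)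
  shuffle_mem S hS T hT := by
    rw [mem_domLi_iff hR] at hS hT ⊢
    refine ⟨hS.1.shuffle hT.1, fun r hr => ?_⟩
    rcases lt_or_ge r 0 with hr0 | hr0
    · exact ⟨0, summable_zero, fun n z hz => absurd (norm_nonneg z) (by linarith)⟩
    obtain ⟨u, hu, hu'⟩ := hS.2 r hr
    obtain ⟨v, hv, hv'⟩ := hT.2 r hr
    -- The majorants are nonnegative because they bound a norm at `z = 0`, so their Cauchy product
    -- is summable.
    have hu0 (n : ℕ) : 0 ≤ u n := (norm_nonneg _).trans (hu' n 0 (by simpa using hr0))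
    have hv0 (n : ℕ) : 0 ≤ v n := (norm_nonneg _).trans (hv' n 0 (by simpa using hr0))
    refine ⟨_, summable_sum_mul_antidiagonal_of_summable_mul (hu.mul_of_nonneg hv hu0 hv0),
      fun n z hz => ?_⟩
    rw [liComponent_shuffle hS.1 hT.1 (hS.1.shuffle hT.1) n (hz.trans_lt (hr.trans_le hR))]
    refine norm_sum_le_of_le _ fun p _ => ?_
    rw [norm_mul]
    exact mul_le_mul (hu' _ z hz) (hv' _ z hz) (norm_nonneg _) (hu0 _)

theorem isShuffleCharacterOn_liSeries {R : ℝ} (hR : R ≤ 1) :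
    IsShuffleCharacterOn (domLi R) (Metric.ball (0 : ℂ) R) liSeries where
  holomorphic S hS := by
    have h := hS.2.hasSumLocallyUniformlyOn
    exact TendstoLocallyUniformlyOn.differentiableOn h (Filter.Eventually.of_forall fun F =>
      DifferentiableOn.fun_sum fun n _ => differentiableOn_liComponent hS.1 n hR)
      Metric.isOpen_ball
  map_one z _ := by
    rw [liSeries, tsum_eq_single 0 fun n hn => by simp [liComponent_oneSeries, hn]]
    simp [liComponent_oneSeries]
  map_add S hS T hT z hz := by
    rw [mem_ball_zero_iff] at hz
    simp only [liSeries, liComponent_add]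
    exact (summable_norm_liComponent hR hS hz).of_norm.tsum_add
      (summable_norm_liComponent hR hT hz).of_norm
  map_smul c S _ z _ := by
    simp only [liSeries, liComponent_smul, tsum_mul_left]
  map_shuffle S hS T hT z hz := by
    rw [mem_ball_zero_iff] at hz
    rw [liSeries, liSeries, liSeries, tsum_mul_tsum_eq_tsum_sum_antidiagonal_of_summable_norm
      (summable_norm_liComponent hR hS hz) (summable_norm_liComponent hR hT hz)]
    exact tsum_congr fun n =>
      liComponent_shuffle hS.1 hT.1 (hS.1.shuffle hT.1) n (hz.trans_le hR)

/-! ### Series in the letter `x₁` -/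

/-- The shuffle recursion becomes Pascal's rule. -/
theorem shuffleWords_replicate (i j : ℕ) :
    shuffleWords (List.replicate i Letter.x1) (List.replicate j Letter.x1) =
      List.replicate ((i + j).choose i) (List.replicate (i + j) Letter.x1) := by
  induction i generalizing j with
  | zero => simp [shuffleWords]
  | succ i ih =>
    induction j with
    | zero => simp [shuffleWords, List.replicate_succ]
    | succ j ihj =>
      have h := ih (j + 1)
      rw [List.replicate_succ (n := j)] at h
      rw [List.replicate_succ (n := i)] at ihj
      rw [List.replicate_succ (n := i), List.replicate_succ (n := j), shuffleWords, h, ihj,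
        List.map_replicate, List.map_replicate, ← List.replicate_succ, ← List.replicate_succ,
        show i + 1 + (j + 1) = (i + (j + 1)) + 1 by ring, Nat.choose_succ_succ,
        show i + 1 + j = i + (j + 1) by ring, List.replicate_add (m := Nat.choose _ _)]

theorem eq_replicate_of_mem_shuffleWords {u v : Word} {n : ℕ}
    (h : List.replicate n Letter.x1 ∈ shuffleWords u v) :
    u = List.replicate u.length Letter.x1 ∧ v = List.replicate v.length Letter.x1 := by
  have hp := perm_append_of_mem_shuffleWords u v _ h
  have hx (a : Letter) (ha : a ∈ u ++ v) : a = Letter.x1 :=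
    List.eq_of_mem_replicate (hp.mem_iff.2 ha)
  exact ⟨List.eq_replicate_of_mem fun a ha => hx a (List.mem_append_left _ ha),
    List.eq_replicate_of_mem fun a ha => hx a (List.mem_append_right _ ha)⟩

/-- The shuffle product on powers of `x₁` is the binomial convolution. -/
theorem shuffle_replicate (S T : Series) (n : ℕ) :
    shuffle S T (List.replicate n Letter.x1) =
      ∑ p ∈ Finset.HasAntidiagonal.antidiagonal n, S (List.replicate p.1 Letter.x1) *
        T (List.replicate p.2 Letter.x1) * (n.choose p.1 : ℂ) := by
  rw [shuffle, List.length_replicate]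
  refine Finset.sum_congr rfl fun p hp => ?_
  rw [Finset.HasAntidiagonal.mem_antidiagonal] at hp
  rw [Finset.sum_eq_single (List.replicate p.1 Letter.x1),
    Finset.sum_eq_single (List.replicate p.2 Letter.x1), shuffleWords_replicate, hp,
    List.count_replicate_self]
  · intro v hv hne
    rw [List.count_eq_zero_of_not_mem, Nat.cast_zero, mul_zero]
    intro h
    have h' := (eq_replicate_of_mem_shuffleWords h).2
    rw [mem_wordsOfLength.1 hv] at h'
    exact hne h'
  · exact fun h => absurd (mem_wordsOfLength.2 List.length_replicate) h
  · intro u hu hne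
    refine Finset.sum_eq_zero fun v _ => ?_
    rw [List.count_eq_zero_of_not_mem, Nat.cast_zero, mul_zero]
    intro h
    have h' := (eq_replicate_of_mem_shuffleWords h).1
    rw [mem_wordsOfLength.1 hu] at h'
    exact hne h'
  · exact fun h => absurd (mem_wordsOfLength.2 List.length_replicate) h

/-! ### Exponential generating series and Stirling numbers -/

/-- The exponential generating series of the coefficients of the powers of `x₁`. -/
noncomputable def x1GeneratingSeries (S : Series) : PowerSeries ℂ :=
  PowerSeries.mk fun n => S (List.replicate n Letter.x1) / n.factorial

theorem x1GeneratingSeries_shuffle (S T : Series) :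
    x1GeneratingSeries (shuffle S T) = x1GeneratingSeries S * x1GeneratingSeries T := by
  ext n
  rw [coeff_mul]
  simp only [x1GeneratingSeries, coeff_mk]
  rw [shuffle_replicate, Finset.sum_div]
  refine Finset.sum_congr rfl fun p hp => ?_
  rw [Finset.HasAntidiagonal.mem_antidiagonal] at hp
  have h : (n.choose p.1 : ℂ) * p.1.factorial * p.2.factorial = n.factorial := by
    rw [← hp, Nat.choose_symm_add]
    exact_mod_cast Nat.add_choose_mul_factorial_mul_factorial p.1 p.2
  have h1 : (p.1.factorial : ℂ) ≠ 0 := by exact_mod_cast p.1.factorial_ne_zero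
  have h2 : (p.2.factorial : ℂ) ≠ 0 := by exact_mod_cast p.2.factorial_ne_zero
  have h3 : (n.choose p.1 : ℂ) ≠ 0 := by
    exact_mod_cast (Nat.choose_pos (hp ▸ Nat.le_add_right _ _)).ne'
  rw [← h]
  field_simp

theorem x1GeneratingSeries_x1Plus : x1GeneratingSeries x1Plus = PowerSeries.exp ℂ - 1 := by
  ext n
  rw [x1GeneratingSeries, coeff_mk, map_sub, coeff_exp, coeff_one, x1Plus]
  cases n with
  | zero => simp
  | succ n => simp

theorem x1GeneratingSeries_shufflePow (m : ℕ) :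
    x1GeneratingSeries (shufflePow x1Plus m) = (PowerSeries.exp ℂ - 1) ^ m := by
  induction m with
  | zero =>
    ext n
    cases n with
    | zero => simp [x1GeneratingSeries, shufflePow, oneSeries]
    | succ n => simp [x1GeneratingSeries, shufflePow, oneSeries, coeff_one]
  | succ m ih =>
    rw [shufflePow, x1GeneratingSeries_shuffle, ih, x1GeneratingSeries_x1Plus, pow_succ']

/-- The exponential generating series of the Stirling numbers of the second kind. -/
theorem coeff_exp_sub_one_pow (n m : ℕ) :
    coeff n ((PowerSeries.exp ℂ - 1) ^ m) * n.factorial =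
      ((m.factorial * Nat.stirlingSecond n m : ℕ) : ℂ) := by
  induction n generalizing m with
  | zero =>
    cases m with
    | zero => simp
    | succ m => simp [Nat.stirlingSecond_zero_succ]
  | succ n ih =>
    cases m with
    | zero => simp [coeff_one, Nat.stirlingSecond_succ_zero]
    | succ m =>
      -- Writing `eˣ = (eˣ - 1) + 1` in the derivative gives the Stirling recurrence
      -- coefficientwise.
      have hd : derivative ℂ ((PowerSeries.exp ℂ - 1) ^ (m + 1)) =
          ((m + 1 : ℕ) : ℂ) • ((PowerSeries.exp ℂ - 1) ^ (m + 1) +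
            (PowerSeries.exp ℂ - 1) ^ m) := by
        rw [Derivation.leibniz_pow, map_sub, derivative_exp, derivative_one, Nat.cast_smul_eq_nsmul,
          Nat.add_sub_cancel, smul_eq_mul]
        congr 1
        ring
      have hc := congrArg (coeff n) hd
      rw [coeff_derivative, coeff_smul, map_add, smul_eq_mul] at hc
      rw [Nat.factorial_succ, Nat.cast_mul, ← mul_assoc, Nat.cast_add_one, hc, mul_assoc, add_mul,
        ih, ih, Nat.stirlingSecond_succ_succ, Nat.factorial_succ]
      push_cast
      ring

theorem shufflePow_x1Plus_replicate (n m : ℕ) :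
    shufflePow x1Plus m (List.replicate n Letter.x1) =
      ((m.factorial * Nat.stirlingSecond n m : ℕ) : ℂ) := by
  rw [← coeff_exp_sub_one_pow, ← x1GeneratingSeries_shufflePow, x1GeneratingSeries, coeff_mk]
  have : (n.factorial : ℂ) ≠ 0 := by exact_mod_cast n.factorial_ne_zero
  field_simp

theorem eq_replicate_of_shufflePow_x1Plus_ne_zero {m : ℕ} {w : Word}
    (h : shufflePow x1Plus m w ≠ 0) : w = List.replicate w.length Letter.x1 := by
  induction m generalizing w with
  | zero =>
    by_cases hw : w = []
    · simp [hw]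
    · simp [shufflePow, oneSeries, hw] at h
  | succ m ih =>
    obtain ⟨u, v, hu, hv, hw⟩ := exists_mem_shuffleWords_of_shuffle_ne_zero h
    have hu' : ∀ a ∈ u, a = Letter.x1 := by
      by_cases hex : ∃ n : ℕ, u = List.replicate (n + 1) Letter.x1
      · obtain ⟨n, rfl⟩ := hex
        exact fun a ha => List.eq_of_mem_replicate ha
      · exact absurd (by simp [x1Plus, hex]) hu
    have hv' : ∀ a ∈ v, a = Letter.x1 := fun a ha => List.eq_of_mem_replicate (ih hv ▸ ha)
    refine List.eq_replicate_of_mem fun a ha => ?_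
    rcases List.mem_append.1 ((perm_append_of_mem_shuffleWords u v w hw).mem_iff.1 ha) with h | h
    exacts [hu' a h, hv' a h]

theorem witness_replicate (t : ℂ) (n : ℕ) :
    witness t (List.replicate n Letter.x1) =
      ∑ m ∈ Finset.range (n + 1), t ^ m * ((m.factorial * Nat.stirlingSecond n m : ℕ) : ℂ) := by
  simp only [witness, shufflePow_x1Plus_replicate]
  -- `S₂(n, m) = 0` for `m > n`, so the support is finite and `finsum` does not take its default
  -- value.
  refine finsum_eq_sum_of_support_subset _ fun m hm => ?_
  rw [Finset.coe_range, Set.mem_Iio, Nat.lt_succ_iff]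
  by_contra hlt
  exact hm (by simp [Nat.stirlingSecond_eq_zero_of_lt (not_le.1 hlt)])

theorem eq_replicate_of_witness_ne_zero {t : ℂ} {w : Word} (h : witness t w ≠ 0) :
    w = List.replicate w.length Letter.x1 := by
  by_contra hw
  refine h ((finsum_congr fun m => ?_).trans finsum_zero)
  by_cases hm : shufflePow x1Plus m w = 0
  · rw [hm, mul_zero]
  · exact absurd (eq_replicate_of_shufflePow_x1Plus_ne_zero hm) hw

theorem isAdmissible_witness (t : ℂ) : IsAdmissible (witness t) := fun w hw => by
  rw [eq_replicate_of_witness_ne_zero hw]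
  exact admissibleWord_replicate _

theorem liComponent_witness (t : ℂ) (n : ℕ) (z : ℂ) :
    liComponent (witness t) n z =
      witness t (List.replicate n Letter.x1) * liWord (List.replicate n Letter.x1) z := by
  rw [liComponent, Finset.sum_eq_single (List.replicate n Letter.x1)]
  · intro w hw hne
    by_cases h : witness t w = 0
    · rw [h, zero_mul]
    · have h' := eq_replicate_of_witness_ne_zero h
      rw [mem_wordsOfLength.1 hw] at h'
      exact absurd h' hne
  · exact fun h => absurd (mem_wordsOfLength.2 List.length_replicate) h

/-! ### The polylogarithms of the powers of `x₁` -/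

/-- Shuffling `x₁` with `x₁ⁿ` gives `n + 1` copies of `x₁ⁿ⁺¹`; the factorial accumulates. -/
theorem liPowerSeries_replicate (n : ℕ) :
    liPowerSeries [Letter.x1] ^ n =
      (n.factorial : ℂ) • liPowerSeries (List.replicate n Letter.x1) := by
  induction n with
  | zero => simp [liPowerSeries]
  | succ n ih =>
    have h := liPowerSeries_mul _ _ (admissibleWord_replicate 1) (admissibleWord_replicate n)
    rw [shuffleWords_replicate, List.map_replicate, List.sum_replicate, Nat.choose_one_right,
      ← Nat.cast_smul_eq_nsmul ℂ, add_comm 1 n] at h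
    rw [pow_succ', ih, mul_smul_comm]
    rw [show liPowerSeries [Letter.x1] = liPowerSeries (List.replicate 1 Letter.x1) from rfl, h,
      smul_smul, Nat.factorial_succ]
    push_cast
    rw [mul_comm]

theorem coeff_liPowerSeries_x1 (n : ℕ) : coeff n (liPowerSeries [Letter.x1]) = 1 / (n : ℂ) := by
  rw [liPowerSeries, coeff_eulerIntegral]
  cases n with
  | zero => simp
  | succ n =>
    rw [coeff_succ_letterSeries_x1_mul]
    simp [liPowerSeries, coeff_one]

theorem evalAt_liPowerSeries_x1 {z : ℂ} (hz : ‖z‖ < 1) :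
    evalAt z (liPowerSeries [Letter.x1]) = -Complex.log (1 - z) := by
  rw [evalAt, ← (Complex.hasSum_taylorSeries_neg_log hz).tsum_eq]
  exact tsum_congr fun n => by rw [coeff_liPowerSeries_x1]; ring

theorem liWord_replicate (n : ℕ) {z : ℂ} (hz : ‖z‖ < 1) :
    liWord (List.replicate n Letter.x1) z = (-Complex.log (1 - z)) ^ n / n.factorial := by
  have hs := summableAt_liPowerSeries (norm_nonneg z) hz [Letter.x1]
  have : (n.factorial : ℂ) ≠ 0 := by exact_mod_cast n.factorial_ne_zero
  rw [liWord_eq_evalAt (admissibleWord_replicate n) hz, ← evalAt_liPowerSeries_x1 hz,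
    ← evalAt_pow hs, liPowerSeries_replicate, evalAt_smul, mul_div_cancel_left₀ _ this]

/-- The Taylor coefficients are nonnegative, so the modulus is largest on the positive real axis.
This makes real points decisive for the witness. -/
theorem norm_log_one_sub_le {z : ℂ} {r : ℝ} (hz : ‖z‖ ≤ r) (hr : r < 1) :
    ‖-Complex.log (1 - z)‖ ≤ -Real.log (1 - r) := by
  have hz1 : ‖z‖ < 1 := hz.trans_lt hr
  have h := (summableAt_liPowerSeries (norm_nonneg z) hz1 [Letter.x1]).norm_evalAt_le
  rw [evalAt_liPowerSeries_x1 hz1] at h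
  have h0 : |(‖z‖)| < 1 := by rwa [abs_norm]
  have hreal := Real.hasSum_pow_div_log_of_abs_lt_one h0
  refine h.trans ?_
  have e : ∑' n, ‖coeff n (liPowerSeries [Letter.x1])‖ * ‖z‖ ^ n = -Real.log (1 - ‖z‖) := by
    have hsum : Summable fun n => ‖coeff n (liPowerSeries [Letter.x1])‖ * ‖z‖ ^ n :=
      summableAt_liPowerSeries (norm_nonneg z) hz1 [Letter.x1]
    rw [hsum.tsum_eq_zero_add, ← hreal.tsum_eq, coeff_liPowerSeries_x1]
    simp only [Nat.cast_zero, div_zero, norm_zero, zero_mul, zero_add]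
    refine tsum_congr fun n => ?_
    rw [coeff_liPowerSeries_x1, norm_div, norm_one, Complex.norm_natCast]
    push_cast
    ring
  rw [e]
  have := Real.log_le_log (x := 1 - r) (y := 1 - ‖z‖) (by linarith) (by linarith)
  linarith

/-! ### Convergence of the witness -/

theorem hasSum_stirlingSecond (m : ℕ) (x : ℝ) (hx : 0 ≤ x) :
    HasSum (fun n : ℕ => (m.factorial * Nat.stirlingSecond n m : ℕ) * x ^ n / n.factorial)
      ((Real.exp x - 1) ^ m) := by
  have hnorm : ‖(x : ℂ)‖ = x := by simp [abs_of_nonneg hx]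
  have hexp : SummableAt ‖(x : ℂ)‖ (PowerSeries.exp ℂ) := by
    rw [hnorm]
    refine (Real.summable_pow_div_factorial x).congr fun n => ?_
    rw [coeff_exp]
    simp [div_eq_inv_mul]
  have hone : SummableAt ‖(x : ℂ)‖ ((-1 : ℂ) • (1 : PowerSeries ℂ)) := (summableAt_one _).smul _
  have hsub : PowerSeries.exp ℂ - 1 = PowerSeries.exp ℂ + (-1 : ℂ) • (1 : PowerSeries ℂ) := by
    rw [neg_one_smul, sub_eq_add_neg]
  have hs : SummableAt ‖(x : ℂ)‖ (PowerSeries.exp ℂ - 1) := by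
    rw [hsub]; exact hexp.add (norm_nonneg _) hone
  have hval : evalAt x (PowerSeries.exp ℂ - 1) = ((Real.exp x - 1 : ℝ) : ℂ) := by
    rw [hsub, evalAt_add hexp hone, evalAt_smul, evalAt_one]
    have : evalAt (x : ℂ) (PowerSeries.exp ℂ) = Complex.exp x := by
      rw [evalAt, Complex.exp_eq_exp_ℂ, NormedSpace.exp_eq_tsum_div]
      refine tsum_congr fun n => ?_
      rw [coeff_exp]
      simp [div_eq_inv_mul]
    rw [this]
    push_cast
    ring
  have h := (hs.pow (norm_nonneg _) m).hasSum
  rw [evalAt_pow hs, hval] at h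
  rw [← Complex.hasSum_ofReal]
  push_cast at h ⊢
  convert! h using 2 with n
  have hn : (n.factorial : ℂ) ≠ 0 := by exact_mod_cast n.factorial_ne_zero
  rw [eq_div_of_mul_eq hn (coeff_exp_sub_one_pow n m)]
  push_cast
  ring

/-- The polynomials `∑ m! S₂(n, m) tᵐ` have the exponential generating function
`1 / (1 - t (eˣ - 1))`, and it converges at `x ≥ 0` if and only if `t (eˣ - 1) < 1`. -/
theorem summable_stirlingSecond_iff {t x : ℝ} (ht : 0 ≤ t) (hx : 0 ≤ x) :
    (Summable fun n : ℕ => (∑ m ∈ Finset.range (n + 1),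
      t ^ m * ((m.factorial * Nat.stirlingSecond n m : ℕ) : ℝ)) * (x ^ n / n.factorial)) ↔
      t * (Real.exp x - 1) < 1 := by
  -- Nonnegative double family, summed both ways: over `n` first it gives the geometric series, over
  -- `m` first the series in question.
  set f : ℕ × ℕ → ℝ := fun p =>
    t ^ p.1 * ((p.1.factorial * Nat.stirlingSecond p.2 p.1 : ℕ) * x ^ p.2 / p.2.factorial) with hf
  have hf0 : 0 ≤ f := fun p => by simp only [hf, Pi.zero_apply]; positivity
  have hrow (m : ℕ) : HasSum (fun n => f (m, n)) ((t * (Real.exp x - 1)) ^ m) := by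
    rw [mul_pow]
    exact (hasSum_stirlingSecond m x hx).mul_left _
  have hcol (n : ℕ) : HasSum (fun m => f (m, n)) ((∑ m ∈ Finset.range (n + 1),
      t ^ m * ((m.factorial * Nat.stirlingSecond n m : ℕ) : ℝ)) * (x ^ n / n.factorial)) := by
    rw [Finset.sum_mul]
    have e (m : ℕ) : t ^ m * ((m.factorial * Nat.stirlingSecond n m : ℕ) : ℝ) *
        (x ^ n / n.factorial) = f (m, n) := by simp only [hf]; ring
    simp only [e]
    refine hasSum_sum_of_ne_finset_zero fun m hm => ?_
    have : n < m := by simpa [Nat.lt_succ_iff] using hm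
    simp [hf, Nat.stirlingSecond_eq_zero_of_lt this]
  have h1 := summable_prod_of_nonneg hf0
  have h2 := summable_prod_of_nonneg (f := f ∘ Prod.swap) fun p => hf0 p.swap
  have h3 : Summable (f ∘ Prod.swap) ↔ Summable f := (Equiv.prodComm ℕ ℕ).summable_iff
  simp only [Function.comp_apply, Prod.swap_prod_mk, (hcol _).tsum_eq, (hcol _).summable,
    implies_true, true_and] at h2
  simp only [(hrow _).tsum_eq, (hrow _).summable, implies_true, true_and] at h1
  rw [← h2, h3, h1, summable_geometric_iff_norm_lt_one, Real.norm_eq_abs, abs_of_nonneg]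
  have := Real.one_le_exp hx
  exact mul_nonneg ht (by linarith)

theorem mul_exp_neg_log_lt_one_iff {t r : ℝ} (hr : r < 1) :
    t * (Real.exp (-Real.log (1 - r)) - 1) < 1 ↔ (1 + t) * r < 1 := by
  have h : 0 < 1 - r := by linarith
  rw [Real.exp_neg, Real.exp_log h, show (1 - r)⁻¹ - 1 = r / (1 - r) by field_simp; ring,
    ← mul_div_assoc, div_lt_one h]
  constructor <;> intro h <;> linarith

theorem neg_log_one_sub_nonneg {r : ℝ} (h0 : 0 ≤ r) (h1 : r < 1) : 0 ≤ -Real.log (1 - r) := by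
  have := Real.log_nonpos (x := 1 - r) (by linarith) (by linarith)
  linarith

theorem witness_ofReal_replicate (t : ℝ) (n : ℕ) :
    witness (t : ℂ) (List.replicate n Letter.x1) = ((∑ m ∈ Finset.range (n + 1),
      t ^ m * ((m.factorial * Nat.stirlingSecond n m : ℕ) : ℝ) : ℝ) : ℂ) := by
  rw [witness_replicate]
  push_cast
  rfl

/-- Equality `(1 + t) * R = 1` is allowed since only radii `r < R` are tested. -/
theorem witness_mem_domLi {t R : ℝ} (ht : 0 ≤ t) (hR : R ≤ 1) (h : (1 + t) * R ≤ 1) :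
    witness (t : ℂ) ∈ domLi R := by
  refine (mem_domLi_iff hR).2 ⟨isAdmissible_witness _, fun r hr => ?_⟩
  rcases lt_or_ge r 0 with hr0 | hr0
  · exact ⟨0, summable_zero, fun n z hz => absurd (norm_nonneg z) (by linarith)⟩
  have hr1 : r < 1 := hr.trans_le hR
  refine ⟨_, (summable_stirlingSecond_iff ht (neg_log_one_sub_nonneg hr0 hr1)).2
    ((mul_exp_neg_log_lt_one_iff hr1).2 (by nlinarith)), fun n z hz => ?_⟩
  rw [liComponent_witness, liWord_replicate n (hz.trans_lt hr1), witness_ofReal_replicate,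
    norm_mul, norm_div, norm_pow, Complex.norm_natCast, Complex.norm_real, Real.norm_eq_abs,
    abs_of_nonneg (Finset.sum_nonneg fun m _ => by positivity)]
  gcongr
  exact norm_log_one_sub_le hz hr1

theorem witness_notMem_domLi {t R : ℝ} (ht : 0 ≤ t) (hR : R ≤ 1) (h : 1 < (1 + t) * R) :
    witness (t : ℂ) ∉ domLi R := by
  intro hmem
  have ht1 : 0 < 1 + t := by linarith
  -- The pole of `1 / (1 - tz/(1-z)) = (1-z) / (1 - (1+t)z)`; it lies inside the disk, and there the
  -- geometric ratio is exactly 1.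
  set r : ℝ := (1 + t)⁻¹ with hr
  have hr0 : 0 < r := inv_pos.2 ht1
  have hrR : r < R := by rw [hr, inv_lt_iff_one_lt_mul₀' ht1]; exact h
  have hr1 : r < 1 := hrR.trans_le hR
  have hz : ‖(r : ℂ)‖ < R := by rwa [Complex.norm_real, Real.norm_eq_abs, abs_of_pos hr0]
  have hs := summable_norm_liComponent hR hmem hz
  have hlog : -Complex.log (1 - (r : ℂ)) = ((-Real.log (1 - r) : ℝ) : ℂ) := by
    rw [Complex.ofReal_neg, Complex.ofReal_log (by linarith)]
    push_cast
    rfl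
  have hl := neg_log_one_sub_nonneg hr0.le hr1
  have key : Summable fun n : ℕ => (∑ m ∈ Finset.range (n + 1),
      t ^ m * ((m.factorial * Nat.stirlingSecond n m : ℕ) : ℝ)) *
        ((-Real.log (1 - r)) ^ n / n.factorial) := by
    refine hs.congr fun n => ?_
    rw [liComponent_witness, liWord_replicate n (hz.trans_le hR), witness_ofReal_replicate, hlog,
      norm_mul, norm_div, norm_pow, Complex.norm_natCast, Complex.norm_real, Complex.norm_real,
      Real.norm_of_nonneg (Finset.sum_nonneg fun m _ => by positivity), Real.norm_of_nonneg hl]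
  rw [summable_stirlingSecond_iff ht hl, mul_exp_neg_log_lt_one_iff hr1, hr,
    mul_inv_cancel₀ ht1.ne'] at key
  exact lt_irrefl _ key

theorem witness_mem_domLi_and_notMem_domLi {R₁ R₂ t : ℝ} (h₁ : 0 < R₁) (h₁₂ : R₁ < R₂)
    (h₂ : R₂ ≤ 1) (ht₂ : 1 / R₂ - 1 < t) (ht₁ : t < 1 / R₁ - 1) :
    witness (t : ℂ) ∈ domLi R₁ ∧ witness (t : ℂ) ∉ domLi R₂ := by
  have hR₂ : 0 < R₂ := h₁.trans h₁₂
  have ht : 0 ≤ t := by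
    have := one_le_one_div hR₂ h₂
    linarith
  refine ⟨witness_mem_domLi ht (h₁₂.le.trans h₂) ?_, witness_notMem_domLi ht h₂ ?_⟩
  · exact ((lt_div_iff₀ h₁).1 (by linarith)).le
  · exact (div_lt_iff₀ hR₂).1 (by linarith)

theorem strictAntiOn_domLi : StrictAntiOn domLi (Set.Ioc (0 : ℝ) 1) := by
  intro R₁ h₁ R₂ h₂ h
  obtain ⟨t, ht₂, ht₁⟩ := exists_between
    (sub_lt_sub_right (one_div_lt_one_div_of_lt h₁.1 h) (1 : ℝ))
  have hw := witness_mem_domLi_and_notMem_domLi h₁.1 h h₂.2 ht₂ ht₁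
  exact ⟨domLi_subset_domLi h.le, fun hsub => hw.2 (hsub hw.1)⟩

end LocalPolylog

theorem proposition1 :
    -- the map `R ↦ Dom_R(Li)` is strictly decreasing on `]0, 1]`
    StrictAntiOn LocalPolylog.domLi (Set.Ioc (0 : ℝ) 1) ∧
    -- strictness is witnessed by `S(t)`
    (∀ R₁ R₂ t : ℝ, 0 < R₁ → R₁ < R₂ → R₂ ≤ 1 → 1 / R₂ - 1 < t → t < 1 / R₁ - 1 →
      LocalPolylog.witness (t : ℂ) ∈ LocalPolylog.domLi R₁ ∧
      LocalPolylog.witness (t : ℂ) ∉ LocalPolylog.domLi R₂) ∧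
    -- the coefficients of `S(t)` in terms of Stirling numbers of the second kind
    (∀ (t : ℂ) (n : ℕ),
      LocalPolylog.witness t (List.replicate n LocalPolylog.Letter.x1) =
        ∑ m ∈ Finset.range (n + 1), t ^ m * ((m.factorial * Nat.stirlingSecond n m : ℕ) : ℂ)) ∧
    -- each `Dom_R(Li)` is a shuffle subalgebra, on which `Li` is a shuffle character
    (∀ R : ℝ, 0 < R → R ≤ 1 →
      LocalPolylog.IsShuffleSubalgebra (LocalPolylog.domLi R) ∧
      LocalPolylog.IsShuffleCharacterOn (LocalPolylog.domLi R) (Metric.ball (0 : ℂ) R)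
        LocalPolylog.liSeries) := by
  exact ⟨LocalPolylog.strictAntiOn_domLi,
    fun _ _ _ h₁ h₁₂ h₂ ht₂ ht₁ =>
      LocalPolylog.witness_mem_domLi_and_notMem_domLi h₁ h₁₂ h₂ ht₂ ht₁,
    LocalPolylog.witness_replicate,
    fun _ _ hR => ⟨LocalPolylog.isShuffleSubalgebra_domLi hR,
      LocalPolylog.isShuffleCharacterOn_liSeries hR⟩⟩
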